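/- For a finite simple graph $G$ let $D(G)$ be the diagonal matrix of its vertex degrees, $A(G)$ its adjacency matrix, and for $\alpha\in[0,1]$ let $A_\alpha(G)=\alpha D(G)+(1-\alpha)A(G)$. The $A_\alpha$-index $\lambda_\alpha(G)$ of $G$ is the largest eigenvalue of the real symmetric matrix $A_\alpha(G)$. The independence number of $G$ is the maximum size of a set of pairwise non-adjacent vertices. For integers $s,t\ge 0$ let $G_2(s,t)$ be the tree on $s+t+3$ vertices obtained from the path $v_1v_3v_2$ by attaching $s$ pendant edges at $v_1$ and $t$ pendant edges at $v_2$. **Theorem.** Let $n\ge 5$ be an integer, let $\alpha\in[0,1)$, and let $G$ be a connected graph on $n$ vertices with independence number $n-2$. Then $$\lambda_\alpha(G)\ \ge\ \lambda_\alpha\!\left(G_2\!\left(\left\lceil\tfrac{n-3}{2}\right\rceil,\left\lfloor\tfrac{n-3}{2}\right\rfloor\right)\right),$$ with equality if and only if $G\cong G_2\!\left(\left\lceil\frac{n-3}{2}\right\rceil,\left\lfloor\frac{n-3}{2}\right\rfloor\right)$. -/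

import Mathlib

namespace SimpleGraph

/-- The matrix `A_α(G) = α D(G) + (1 - α) A(G)` of a finite graph, where `D(G)` is the diagonal
matrix of vertex degrees and `A(G)` is the adjacency matrix. -/
noncomputable def alphaMatrix {V : Type*} [Fintype V] (G : SimpleGraph V) (α : ℝ) :
    Matrix V V ℝ :=
  open Classical in α • G.degMatrix ℝ + (1 - α) • G.adjMatrix ℝ

/-- The `A_α`-index of a finite graph: the largest (real) eigenvalue of `A_α(G)`. -/
noncomputable def alphaIndex {V : Type*} [Fintype V] (G : SimpleGraph V) (α : ℝ) : ℝ :=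
  open Classical in sSup (spectrum ℝ (G.alphaMatrix α))

theorem alphaMatrix_isHermitian {V : Type*} [Fintype V] (G : SimpleGraph V) (α : ℝ) :
    (G.alphaMatrix α).IsHermitian := by
  classical
  ext i j
  simp only [alphaMatrix, degMatrix, Matrix.conjTranspose_apply, Matrix.add_apply,
    Matrix.smul_apply, Matrix.diagonal_apply, adjMatrix_apply, star_trivial, G.adj_comm j i]
  by_cases h : i = j
  · subst h; rfl
  · simp [h, Ne.symm h]

/-- On a nonempty vertex set the supremum in `alphaIndex` is attained: the index really is the
largest eigenvalue. -/
theorem isGreatest_alphaIndex {V : Type*} [Fintype V] [DecidableEq V] [Nonempty V]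
    (G : SimpleGraph V) (α : ℝ) :
    IsGreatest (spectrum ℝ (G.alphaMatrix α)) (G.alphaIndex α) := by
  have h := (G.alphaMatrix_isHermitian α).spectrum_real_eq_range_eigenvalues
  have hne : (spectrum ℝ (G.alphaMatrix α)).Nonempty := h ▸ Set.range_nonempty _
  have hfin : (spectrum ℝ (G.alphaMatrix α)).Finite := h ▸ Set.finite_range _
  have heq : G.alphaIndex α = sSup (spectrum ℝ (G.alphaMatrix α)) := by
    unfold alphaIndex
    congr!
  rw [heq]
  exact ⟨hne.csSup_mem hfin, fun x hx => le_csSup hfin.bddAbove hx⟩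

/-- Generating relation of the edges of `doubleBroom s t`. In the vertex set, `inl 0`, `inl 1`,
`inl 2` are `v₁`, `v₂`, `v₃`, the vertices `inr (inl i)` are the `s` leaves at `v₁`, and the
vertices `inr (inr j)` are the `t` leaves at `v₂`. -/
inductive DoubleBroomEdge (s t : ℕ) :
    Fin 3 ⊕ (Fin s ⊕ Fin t) → Fin 3 ⊕ (Fin s ⊕ Fin t) → Prop
  | v1_v3 : DoubleBroomEdge s t (Sum.inl 0) (Sum.inl 2)
  | v3_v2 : DoubleBroomEdge s t (Sum.inl 2) (Sum.inl 1)
  | v1_leaf (i : Fin s) : DoubleBroomEdge s t (Sum.inl 0) (Sum.inr (Sum.inl i))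
  | v2_leaf (j : Fin t) : DoubleBroomEdge s t (Sum.inl 1) (Sum.inr (Sum.inr j))

/-- The tree `G₂(s, t)` on `s + t + 3` vertices, obtained from the path `v₁ v₃ v₂` by attaching
`s` pendant edges at `v₁` and `t` pendant edges at `v₂`. -/
def doubleBroom (s t : ℕ) : SimpleGraph (Fin 3 ⊕ (Fin s ⊕ Fin t)) :=
  SimpleGraph.fromRel (DoubleBroomEdge s t)

end SimpleGraph

/-! The complement of a maximum independent set is a vertex cover `{a, b}`. Up to isomorphism `G` is
therefore fixed by the numbers `p`, `q`, `r` of vertices joined to `a` only, to `b` only and to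
both, and by `e`, which is 1 or 0 as `a`, `b` are adjacent or not; here `p + q + r = s + t + 1`. Let
`lam` be the index of the balanced broom, `μ = 1 - α`, and suppose the index of `G` is at most
`lam`. Maximizing the form of `A_α - lam` over the entries outside `{a, b}` leaves a nonpositive
form in two variables (`form_nonpos_of_alphaIndex_le`). For the broom the same elimination gives a
singular form, with secular equation `fs * ft = γ * (fs + ft)` and kernel vector `(ft, fs)`
(`doubleBroom_secular`). Testing the form of `G` on that vector, or on `(1, 1)` when `r = 0`, forces
the broom's parameters (`params_eq_of_form_nonpos`). This rigidity yields both the inequality and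
the equality case. -/

namespace SimpleGraph

/-! ### Rayleigh quotients of `A_α` -/

section Rayleigh

variable {V : Type*} [Fintype V] (G : SimpleGraph V)

theorem alphaMatrix_mulVec [DecidableRel G.Adj] (α : ℝ) (x : V → ℝ) (u : V) :
    (G.alphaMatrix α).mulVec x u =
      ∑ v, if G.Adj u v then α * x u + (1 - α) * x v else 0 := by
  classical
  have h1 : (∑ v, if G.Adj u v then α * x u else 0) = α * (G.degree u * x u) := by
    rw [← Finset.sum_filter, Finset.sum_const, ← neighborFinset_eq_filter, card_neighborFinset_eq_degree,
      nsmul_eq_mul]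
    ring
  have h2 : (∑ v, if G.Adj u v then α * x u + (1 - α) * x v else 0) =
      (∑ v, if G.Adj u v then α * x u else 0) + ∑ v, if G.Adj u v then (1 - α) * x v else 0 := by
    rw [← Finset.sum_add_distrib]
    refine Finset.sum_congr rfl fun v _ => ?_
    split_ifs <;> simp
  rw [h2, h1, alphaMatrix, Matrix.add_mulVec, Pi.add_apply, Matrix.smul_mulVec,
    Matrix.smul_mulVec, Pi.smul_apply, Pi.smul_apply, degMatrix, Matrix.mulVec_diagonal,
    adjMatrix_mulVec_apply, smul_eq_mul, smul_eq_mul, neighborFinset_eq_filter, Finset.mul_sum,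
    Finset.sum_filter]
  congr!

theorem dotProduct_alphaMatrix_mulVec [DecidableRel G.Adj] (α : ℝ) (x : V → ℝ) :
    x ⬝ᵥ (G.alphaMatrix α).mulVec x =
      ∑ u, ∑ v, if G.Adj u v then α * x u ^ 2 + (1 - α) * (x u * x v) else 0 := by
  refine Finset.sum_congr rfl fun u _ => ?_
  rw [alphaMatrix_mulVec, Finset.mul_sum]
  refine Finset.sum_congr rfl fun v _ => ?_
  split_ifs <;> ring

theorem dotProduct_alphaMatrix_mulVec_le [Nonempty V] (α : ℝ) (x : V → ℝ) :
    x ⬝ᵥ (G.alphaMatrix α).mulVec x ≤ G.alphaIndex α * (x ⬝ᵥ x) := by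
  classical
  have hA := G.alphaMatrix_isHermitian α
  -- The spectrum of `λ - A` is `λ` minus that of `A`, hence nonnegative for the largest eigenvalue
  -- `λ`.
  have hps : (G.alphaIndex α • (1 : Matrix V V ℝ) - G.alphaMatrix α).PosSemidef := by
    rw [Matrix.posSemidef_iff_isHermitian_and_spectrum_nonneg]
    refine ⟨?_, ?_⟩
    · refine Matrix.IsHermitian.sub ?_ hA
      simp [Matrix.IsHermitian]
    · intro z hz
      rw [← Algebra.algebraMap_eq_smul_one, ← spectrum.singleton_sub_eq] at hz
      obtain ⟨_, rfl, w, hw, rfl⟩ := hz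
      have := (G.isGreatest_alphaIndex α).2 hw
      simpa using this
  have := hps.dotProduct_mulVec_nonneg x
  rw [Matrix.sub_mulVec, Matrix.smul_mulVec, Matrix.one_mulVec, dotProduct_sub, dotProduct_smul,
    smul_eq_mul, star_trivial] at this
  linarith

theorem exists_alphaMatrix_eigenvector [Nonempty V] (α : ℝ) :
    ∃ x : V → ℝ, x ≠ 0 ∧ (G.alphaMatrix α).mulVec x = G.alphaIndex α • x := by
  classical
  have h := (G.isGreatest_alphaIndex α).1
  rw [← Matrix.spectrum_toLin', ← Module.End.hasEigenvalue_iff_mem_spectrum] at h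
  obtain ⟨x, hx⟩ := h.exists_hasEigenvector
  exact ⟨x, hx.2, by simpa using hx.apply_eq_smul⟩

theorem alphaIndex_eq_of_iso {W : Type*} [Fintype W] {G : SimpleGraph V} {H : SimpleGraph W}
    (f : G ≃g H) (α : ℝ) : G.alphaIndex α = H.alphaIndex α := by
  classical
  have h : H.alphaMatrix α = Matrix.reindexAlgEquiv ℝ ℝ f.toEquiv (G.alphaMatrix α) := by
    ext i j
    obtain ⟨i, rfl⟩ := f.surjective i
    obtain ⟨j, rfl⟩ := f.surjective j
    change _ = G.alphaMatrix α (f.symm (f i)) (f.symm (f j))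
    rw [f.symm_apply_apply, f.symm_apply_apply]
    have hadj : H.Adj (f i) (f j) ↔ G.Adj i j := f.map_adj_iff
    by_cases hij : G.Adj i j <;>
      simp [alphaMatrix, degMatrix, Matrix.diagonal_apply, adjMatrix_apply, hadj, hij]
  unfold alphaIndex
  congr 1
  have := AlgEquiv.spectrum_eq (Matrix.reindexAlgEquiv ℝ ℝ f.toEquiv) (G.alphaMatrix α)
  rw [← h] at this
  convert this.symm

end Rayleigh
end SimpleGraph


/-! ### Scalar inequalities from the secular equation -/

/-- Excludes `r = 0` when `s = t`. All quantities are divided by `μ`: `T = α / μ`, `D = (lam - 2α) /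
μ`, `φ = fs / μ`, and `T + (D + T)⁻¹ = β / μ`. If the bound fails, `φ * D = 2` gives `D < 2`, so `z
* (2 + T) > 1`, which is incompatible with `φ * (φ + z) ≤ φ * D = 2`. -/
theorem secular_sum_lt_of_eq {T D φ : ℝ} (hT : 0 ≤ T) (hD : 0 < D) (s : ℕ) (hs : 1 ≤ s)
    (hφ : φ = D + T - s * (T + (D + T)⁻¹)) (hsec : φ * φ = D⁻¹ * (φ + φ)) (hpos : 0 < φ) :
    φ + φ < 2 + (T + (D + T)⁻¹) := by
  by_contra! hcon
  set z := (D + T)⁻¹ with hz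
  have hz0 : 0 < z := by positivity
  have hzy : z * (D + T) = 1 := inv_mul_cancel₀ (by positivity)
  have hs' : (1 : ℝ) ≤ s := by exact_mod_cast hs
  have hφD : φ * D = 2 := by
    field_simp at hsec
    nlinarith
  have h1 : T + z ≤ s * (T + z) := by nlinarith
  have h2 : φ + z ≤ D := by linarith
  have h3 : D < 2 := by nlinarith
  have h4 : 1 < z * (2 + T) := by nlinarith
  nlinarith [mul_nonneg hpos.le (sub_nonneg.2 h2), mul_pos hz0 hz0, mul_nonneg hT hT]

/-- The counterpart for `s = t + 1`, where `ft / μ = φ + B`. If `φ ≥ 1`, then `D = 1/φ + 1/(φ + B)`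
gives `(D - 1) * (1 + B) ≤ 1`, whereas `D - 1 ≥ T + 2z` and `z * (2 + T) > 1` make that product
exceed 1. -/
theorem secular_sum_lt_of_eq_succ {T D φ : ℝ} (hT : 0 ≤ T) (hD : 0 < D) (s : ℕ) (hs : 2 ≤ s)
    (hφ : φ = D + T - s * (T + (D + T)⁻¹))
    (hsec : φ * (φ + (T + (D + T)⁻¹)) = D⁻¹ * (φ + (φ + (T + (D + T)⁻¹)))) :
    φ < 1 := by
  by_contra! hcon
  set z := (D + T)⁻¹ with hz
  have hz0 : 0 < z := by positivity
  have hzy : z * (D + T) = 1 := inv_mul_cancel₀ (by positivity)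
  have hs' : (2 : ℝ) ≤ s := by exact_mod_cast hs
  set B := T + z with hB
  have hB0 : 0 < B := by positivity
  have h1 : 2 * B ≤ s * B := by nlinarith
  have h2 : φ + T + 2 * z ≤ D := by linarith
  have hsec' : D * (φ * (φ + B)) = φ + (φ + B) := by
    rw [hsec, mul_inv_cancel_left₀ hD.ne']
  have hφ0 : 0 < φ := by linarith
  have h5 : D ≤ 1 + 1 / (1 + B) := by
    have : D = 1 / φ + 1 / (φ + B) := by
      field_simp
      linarith
    rw [this]
    have e1 : 1 / φ ≤ 1 := by rw [div_le_one hφ0]; exact hcon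
    have e2 : 1 / (φ + B) ≤ 1 / (1 + B) := by gcongr
    linarith
  have h6 : (D - 1) * (1 + B) ≤ 1 := by
    rw [← le_div_iff₀ (by positivity)]
    linarith
  have h3 : D < 2 := by nlinarith
  have h4 : 1 < z * (2 + T) := by nlinarith
  nlinarith [mul_nonneg hT hT, mul_nonneg hT hz0.le, mul_pos hz0 hz0]

/-- The quadratic form with nonpositive values forced by the index comparison determines the
parameters of the graph. -/
theorem params_eq_of_form_nonpos {α μ lam β γ fs ft : ℝ} {s t p q r e : ℕ}
    (hα : 0 ≤ α) (hμ : 0 < μ) (hd : 0 < lam - 2 * α)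
    (hβ : β = α + μ ^ 2 / (lam - α)) (hγ : γ = μ ^ 2 / (lam - 2 * α))
    (ht : 1 ≤ t) (hst : s = t ∨ s = t + 1)
    (hfs : fs = lam - α - s * β) (hft : ft = lam - α - t * β) (hfs0 : 0 < fs)
    (hsec : fs * ft = γ * (fs + ft))
    (hpq : q ≤ p) (hsum : p + q + r = s + t + 1) (he : e ≤ 1) (hre : r = 0 → e = 1)
    (hform : ∀ x y : ℝ, p * β * x ^ 2 + q * β * y ^ 2 + ((r + e) * α - lam) * (x ^ 2 + y ^ 2)
      + r * γ * (x + y) ^ 2 + 2 * e * μ * (x * y) ≤ 0) :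
    p = s ∧ q = t ∧ r = 1 ∧ e = 0 := by
  have hd' : 0 < lam - α := by linarith
  have hβ0 : 0 < β := by rw [hβ]; positivity
  have hγ0 : 0 < γ := by rw [hγ]; positivity
  -- A pendant vertex contributes at most as much as the part of a common neighbour's contribution
  -- borne by the same cover vertex.
  have hβγ : β ≤ α + γ := by
    rw [hβ, hγ]
    gcongr
    linarith
  have hsumR : (p : ℝ) + q + r = s + t + 1 := by exact_mod_cast hsum
  have hft0 : fs ≤ ft := by
    have : (t : ℝ) ≤ s := by exact_mod_cast (by omega : t ≤ s)
    rw [hfs, hft]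
    nlinarith
  rcases Nat.eq_zero_or_pos r with hr | hr
  · exfalso
    have he1 := hre hr
    subst hr he1
    have h11 := hform 1 1
    norm_num at h11 hsumR
    have hkey : 2 * μ + β ≤ fs + ft := by
      have : ((p : ℝ) + q) * β = (s + t + 1) * β := by rw [hsumR]
      rw [hfs, hft]
      linarith
    have hT : 0 ≤ α / μ := by positivity
    have hD : 0 < (lam - 2 * α) / μ := by positivity
    have hB : β / μ = α / μ + ((lam - 2 * α) / μ + α / μ)⁻¹ := by
      rw [← add_div, inv_div, show lam - 2 * α + α = lam - α by ring, hβ]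
      field_simp
    have hfsμ : fs / μ = (lam - 2 * α) / μ + α / μ -
        s * (α / μ + ((lam - 2 * α) / μ + α / μ)⁻¹) := by
      rw [← hB, hfs]
      field_simp
      ring
    have hγμ : ((lam - 2 * α) / μ)⁻¹ = γ / μ := by
      rw [hγ]
      field_simp
    rcases hst with h | h
    · have hff : ft = fs := by rw [hfs, hft, h]
      rw [hff] at hsec hkey
      have := secular_sum_lt_of_eq hT hD s (by omega) hfsμ (by
        rw [hγμ, ← add_div, div_mul_div_comm, div_mul_div_comm, hsec]) (by positivity)
      rw [← hB, ← add_div, div_lt_iff₀ hμ, add_mul, div_mul_cancel₀ _ hμ.ne'] at this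
      linarith
    · have hff : ft = fs + β := by
        rw [hfs, hft, h]
        push_cast
        ring
      rw [hff] at hsec hkey
      have := secular_sum_lt_of_eq_succ hT hD s (by omega) hfsμ (by
        rw [hγμ, ← hB, ← add_div, ← add_div, div_mul_div_comm, div_mul_div_comm, hsec])
      rw [div_lt_one hμ] at this
      linarith
  -- `(ft, fs)` spans the kernel of the broom's reduced form, so only the differences of the
  -- parameters survive.
  · have hab := hform ft fs
    have hft0' : 0 < ft := by linarith
    have hH : s * β * ft ^ 2 + t * β * fs ^ 2 + (α - lam) * (ft ^ 2 + fs ^ 2)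
        + γ * (ft + fs) ^ 2 = 0 := by
      have : s * β * ft ^ 2 + t * β * fs ^ 2 + (α - lam) * (ft ^ 2 + fs ^ 2)
        + γ * (ft + fs) ^ 2 = (fs + ft) * (γ * (fs + ft) - fs * ft) := by
        have e1 : s * β = lam - α - fs := by linarith
        have e2 : t * β = lam - α - ft := by linarith
        rw [e1, e2]
        ring
      rw [this, hsec]
      ring
    have hsq : fs ^ 2 ≤ ft ^ 2 := by gcongr
    obtain ⟨T, hTdef⟩ : ∃ T, T = α * (ft ^ 2 + fs ^ 2) + γ * (ft + fs) ^ 2 := ⟨_, rfl⟩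
    obtain ⟨E, hE⟩ : ∃ E, E = α * (ft ^ 2 + fs ^ 2) + 2 * μ * (ft * fs) := ⟨_, rfl⟩
    have hE0 : 0 < E := by rw [hE]; positivity
    have hTa : β * ft ^ 2 < T := by
      have : β * ft ^ 2 ≤ (α + γ) * ft ^ 2 := by gcongr
      have h2 : 0 < γ * (2 * ft * fs + fs ^ 2) + α * fs ^ 2 := by positivity
      rw [hTdef]
      linarith
    have hTb : β * fs ^ 2 < T := by
      have : β * fs ^ 2 ≤ β * ft ^ 2 := by gcongr
      linarith
    have hdiff : (p - s : ℝ) * (β * ft ^ 2) + (q - t) * (β * fs ^ 2) + (r - 1) * T + e * E ≤ 0 := by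
      rw [hTdef, hE]
      linarith
    have heE : 0 ≤ e * E := by positivity
    rcases lt_or_ge p s with hps | hps
    -- Near balance and `q ≤ p < s` give `q ≤ t`: pendant vertices are traded for common neighbours,
    -- and each trade strictly increases the value because `T` exceeds both pendant weights.
    · exfalso
      have h1 : (1 : ℝ) ≤ s - p := by
        have : (p : ℝ) + 1 ≤ s := by exact_mod_cast hps
        linarith
      have h2 : (0 : ℝ) ≤ t - q := by
        have : (q : ℝ) ≤ t := by exact_mod_cast (by omega : q ≤ t)
        linarith
      have hr1 : (r : ℝ) - 1 = (s - p) + (t - q) := by linarith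
      rw [hr1] at hdiff
      nlinarith [mul_nonneg h2 (sub_pos.2 hTb).le]
    · have h1 : (0 : ℝ) ≤ p - s := by
        have : (s : ℝ) ≤ p := by exact_mod_cast hps
        linarith
      have h2 : (0 : ℝ) ≤ r - 1 := by
        have : (1 : ℝ) ≤ r := by exact_mod_cast hr
        linarith
      have hq1 : (q : ℝ) - t = -(p - s) - (r - 1) := by linarith
      rw [hq1] at hdiff
      have t1 : 0 ≤ (p - s : ℝ) * (β * ft ^ 2 - β * fs ^ 2) := by
        refine mul_nonneg h1 (sub_nonneg.2 (by gcongr))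
      have t2 : 0 ≤ (r - 1 : ℝ) * (T - β * fs ^ 2) := mul_nonneg h2 (sub_pos.2 hTb).le
      have he0 : e = 0 := by
        by_contra h
        have : 0 < (e : ℝ) * E := by positivity
        linarith
      have hr1 : r = 1 := by
        by_contra h
        have h3 : (0 : ℝ) < r - 1 := by
          have : (1 : ℝ) < r := by exact_mod_cast (by omega : 1 < r)
          linarith
        have := mul_pos h3 (sub_pos.2 hTb)
        linarith
      suffices p = s by omega
      by_contra hne
      have h3 : (0 : ℝ) < p - s := by
        have : (s : ℝ) < p := by exact_mod_cast (by omega : s < p)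
        linarith
      subst he0 hr1
      rcases hst with h | h
      -- With `ft = fs`, moving leaves between `a` and `b` leaves the value at `(1, 1)` at zero, but
      -- the first derivative along `(1, 0)` is `2 * g > 0`. Some `ε` therefore makes the form
      -- positive: `1` if `m ≥ 0`, the vertex `-g / m` of the parabola otherwise.
      · have hff : ft = fs := by rw [hfs, hft, h]
        have hf2 : fs = 2 * γ := by
          rw [hff] at hsec
          have := mul_left_cancel₀ hfs0.ne' (hsec.trans (by ring : _ = fs * (2 * γ)))
          exact this
        have hlam : lam = α + s * β + 2 * γ := by linarith
        obtain ⟨m, hm⟩ : ∃ m : ℝ, m = p * β + α - lam + γ := ⟨_, rfl⟩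
        obtain ⟨g, hg⟩ : ∃ g : ℝ, g = (p - s) * β := ⟨_, rfl⟩
        have hg0 : 0 < g := by rw [hg]; positivity
        have hts : (t : ℝ) = s := by rw [h]
        have hval : ∀ ε : ℝ, m * ε ^ 2 + 2 * ε * g ≤ 0 := by
          intro ε
          have := hform (1 + ε) 1
          push_cast at this hsumR
          have hq : (q : ℝ) = 2 * s - p := by linarith
          rw [hq] at this
          rw [hm, hg]
          rw [hlam] at this ⊢
          linarith
        rcases le_or_gt 0 m with hm0 | hm0
        · have := hval 1
          linarith
        · have := hval (-g / m)
          have e1 : m * (-g / m) ^ 2 + 2 * (-g / m) * g = - (g ^ 2 / m) := by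
            field_simp
            ring
          have : 0 < -(g ^ 2 / m) := by
            rw [neg_pos]
            exact div_neg_of_pos_of_neg (by positivity) hm0
          linarith
      · have hff : ft = fs + β := by
          rw [hfs, hft, h]
          push_cast
          ring
        have : 0 < (p - s : ℝ) * (β * ft ^ 2 - β * fs ^ 2) := by
          refine mul_pos h3 (sub_pos.2 ?_)
          have : fs < ft := by linarith
          gcongr
        linarith


/-- Eliminates one vertex: for `d > 0` this `w` maximizes `2μzw - dw²`. -/
theorem quadratic_at_critical_point {μ d z w : ℝ} (hd : d ≠ 0) (hw : w = μ * z / d) :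
    2 * μ * (z * w) - d * (w * w) = μ ^ 2 / d * z ^ 2 := by
  rw [hw]
  field_simp
  ring

namespace SimpleGraph

/-! ### The double broom and its secular equation -/

section DoubleBroom

theorem doubleBroomEdge_iff {s t : ℕ} {u v : Fin 3 ⊕ (Fin s ⊕ Fin t)} :
    DoubleBroomEdge s t u v ↔ (u = Sum.inl 0 ∧ v = Sum.inl 2) ∨ (u = Sum.inl 2 ∧ v = Sum.inl 1) ∨
      (u = Sum.inl 0 ∧ ∃ i, v = Sum.inr (Sum.inl i)) ∨
      (u = Sum.inl 1 ∧ ∃ j, v = Sum.inr (Sum.inr j)) := by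
  constructor
  · rintro (_ | _ | _ | _) <;> simp
  · rintro (⟨rfl, rfl⟩ | ⟨rfl, rfl⟩ | ⟨rfl, i, rfl⟩ | ⟨rfl, j, rfl⟩) <;> constructor

theorem doubleBroom_adj {s t : ℕ} {u v : Fin 3 ⊕ (Fin s ⊕ Fin t)} :
    (doubleBroom s t).Adj u v ↔ u ≠ v ∧ (DoubleBroomEdge s t u v ∨ DoubleBroomEdge s t v u) :=
  fromRel_adj _ _ _

variable (s t : ℕ) (α : ℝ) (x : Fin 3 ⊕ (Fin s ⊕ Fin t) → ℝ)

theorem doubleBroom_mulVec_zero :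
    ((doubleBroom s t).alphaMatrix α).mulVec x (Sum.inl 0) =
      α * (s + 1) * x (Sum.inl 0) +
        (1 - α) * (x (Sum.inl 2) + ∑ i, x (Sum.inr (Sum.inl i))) := by
  classical
  rw [alphaMatrix_mulVec]
  simp [doubleBroom_adj, doubleBroomEdge_iff, Fin.sum_univ_three, Finset.sum_add_distrib,
    ← Finset.mul_sum]
  ring

theorem doubleBroom_mulVec_one :
    ((doubleBroom s t).alphaMatrix α).mulVec x (Sum.inl 1) =
      α * (t + 1) * x (Sum.inl 1) +
        (1 - α) * (x (Sum.inl 2) + ∑ j, x (Sum.inr (Sum.inr j))) := by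
  classical
  rw [alphaMatrix_mulVec]
  simp [doubleBroom_adj, doubleBroomEdge_iff, Fin.sum_univ_three, Finset.sum_add_distrib,
    ← Finset.mul_sum]
  ring

theorem doubleBroom_mulVec_two :
    ((doubleBroom s t).alphaMatrix α).mulVec x (Sum.inl 2) =
      2 * α * x (Sum.inl 2) + (1 - α) * (x (Sum.inl 0) + x (Sum.inl 1)) := by
  classical
  rw [alphaMatrix_mulVec]
  simp [doubleBroom_adj, doubleBroomEdge_iff, Fin.sum_univ_three]
  ring

theorem doubleBroom_mulVec_left (i : Fin s) :
    ((doubleBroom s t).alphaMatrix α).mulVec x (Sum.inr (Sum.inl i)) =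
      α * x (Sum.inr (Sum.inl i)) + (1 - α) * x (Sum.inl 0) := by
  classical
  rw [alphaMatrix_mulVec]
  simp [doubleBroom_adj, doubleBroomEdge_iff]

theorem doubleBroom_mulVec_right (j : Fin t) :
    ((doubleBroom s t).alphaMatrix α).mulVec x (Sum.inr (Sum.inr j)) =
      α * x (Sum.inr (Sum.inr j)) + (1 - α) * x (Sum.inl 1) := by
  classical
  rw [alphaMatrix_mulVec]
  simp [doubleBroom_adj, doubleBroomEdge_iff]

theorem doubleBroom_alphaIndex_gt (hs : 1 ≤ s) (hα₀ : 0 ≤ α) (hα₁ : α < 1) :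
    2 * α < (doubleBroom s t).alphaIndex α := by
  -- The indicator of the edge `v₁v₃` already gives index at least `1 + α`.
  have h := (doubleBroom s t).dotProduct_alphaMatrix_mulVec_le α (Sum.elim ![1, 0, 1] 0)
  simp [dotProduct, Fin.sum_univ_three, doubleBroom_mulVec_zero, doubleBroom_mulVec_two] at h
  have : (1 : ℝ) ≤ s := by exact_mod_cast hs
  nlinarith

/-- The index of a double broom is a positive root of its secular equation. -/
theorem doubleBroom_secular {lam β γ fs ft : ℝ} (hs : 1 ≤ s) (hα₀ : 0 ≤ α) (hα₁ : α < 1)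
    (hlam : lam = (doubleBroom s t).alphaIndex α)
    (hβ : β = α + (1 - α) ^ 2 / (lam - α)) (hγ : γ = (1 - α) ^ 2 / (lam - 2 * α))
    (hfs : fs = lam - α - s * β) (hft : ft = lam - α - t * β) :
    0 < fs ∧ fs * ft = γ * (fs + ft) := by
  have hd : 0 < lam - 2 * α := by
    have := doubleBroom_alphaIndex_gt s t α hs hα₀ hα₁
    linarith
  have hd' : 0 < lam - α := by linarith
  have hμ : 0 < 1 - α := by linarith
  have hγ0 : 0 < γ := by rw [hγ]; positivity
  -- Taking `(a, b)` to be a unit vector bounds `fs` and `ft` below by `γ > 0`, so no positive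
  -- eigenvector is needed.
  have hray : ∀ a b : ℝ, γ * (a + b) ^ 2 ≤ fs * a ^ 2 + ft * b ^ 2 := by
    intro a b
    have h := (doubleBroom s t).dotProduct_alphaMatrix_mulVec_le α
      (Sum.elim ![a, b, (1 - α) * (a + b) / (lam - 2 * α)]
        (Sum.elim (fun _ => (1 - α) * a / (lam - α)) (fun _ => (1 - α) * b / (lam - α))))
    rw [← hlam] at h
    simp [dotProduct, Fin.sum_univ_three, doubleBroom_mulVec_zero, doubleBroom_mulVec_two,
      doubleBroom_mulVec_one, doubleBroom_mulVec_left, doubleBroom_mulVec_right] at h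
    obtain ⟨u, hu⟩ : ∃ u, u = (1 - α) * a / (lam - α) := ⟨_, rfl⟩
    obtain ⟨v, hv⟩ : ∃ v, v = (1 - α) * b / (lam - α) := ⟨_, rfl⟩
    obtain ⟨w, hw⟩ : ∃ w, w = (1 - α) * (a + b) / (lam - 2 * α) := ⟨_, rfl⟩
    rw [← hu, ← hv, ← hw] at h
    have ku := congrArg (fun y => (s : ℝ) * y) (quadratic_at_critical_point hd'.ne' hu)
    have kv := congrArg (fun y => (t : ℝ) * y) (quadratic_at_critical_point hd'.ne' hv)
    have kw := quadratic_at_critical_point hd.ne' hw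
    rw [hfs, hft, hβ, hγ]
    linarith
  have h10 := hray 1 0
  have h01 := hray 0 1
  norm_num at h10 h01
  refine ⟨by linarith, ?_⟩
  obtain ⟨x, hx0, hx⟩ := (doubleBroom s t).exists_alphaMatrix_eigenvector α
  rw [← hlam] at hx
  have e0 := congrFun hx (Sum.inl 0)
  have e1 := congrFun hx (Sum.inl 1)
  have e2 := congrFun hx (Sum.inl 2)
  have el : ∀ i, x (Sum.inr (Sum.inl i)) = (1 - α) * x (Sum.inl 0) / (lam - α) := by
    intro i
    have := congrFun hx (Sum.inr (Sum.inl i))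
    rw [doubleBroom_mulVec_left, Pi.smul_apply, smul_eq_mul] at this
    rw [eq_div_iff hd'.ne']
    linarith
  have er : ∀ j, x (Sum.inr (Sum.inr j)) = (1 - α) * x (Sum.inl 1) / (lam - α) := by
    intro j
    have := congrFun hx (Sum.inr (Sum.inr j))
    rw [doubleBroom_mulVec_right, Pi.smul_apply, smul_eq_mul] at this
    rw [eq_div_iff hd'.ne']
    linarith
  simp only [doubleBroom_mulVec_zero, doubleBroom_mulVec_one, doubleBroom_mulVec_two, el, er,
    Pi.smul_apply, smul_eq_mul, Finset.sum_const, Finset.card_univ, Fintype.card_fin,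
    nsmul_eq_mul] at e0 e1 e2
  have g0 : fs * x (Sum.inl 0) = (1 - α) * x (Sum.inl 2) := by
    have : s * ((1 - α) ^ 2 / (lam - α)) * x (Sum.inl 0) =
        (1 - α) * (s * ((1 - α) * x (Sum.inl 0) / (lam - α))) := by ring
    rw [hfs, hβ]
    linarith
  have g1 : ft * x (Sum.inl 1) = (1 - α) * x (Sum.inl 2) := by
    have : t * ((1 - α) ^ 2 / (lam - α)) * x (Sum.inl 1) =
        (1 - α) * (t * ((1 - α) * x (Sum.inl 1) / (lam - α))) := by ring
    rw [hft, hβ]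
    linarith
  have g2 : (lam - 2 * α) * x (Sum.inl 2) = (1 - α) * (x (Sum.inl 0) + x (Sum.inl 1)) := by
    linarith
  have hfs0 : 0 < fs := by linarith
  have hft0 : 0 < ft := by linarith
  -- If the central entry vanished, positivity of `fs` and `ft` would kill the whole eigenvector.
  have hc : x (Sum.inl 2) ≠ 0 := by
    intro hc
    rw [hc, mul_zero] at g0 g1
    have z0 := (mul_eq_zero.1 g0).resolve_left hfs0.ne'
    have z1 := (mul_eq_zero.1 g1).resolve_left hft0.ne'
    refine hx0 (funext fun u => ?_)
    rcases u with u | i | j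
    · fin_cases u <;> simp [z0, z1, hc]
    · simp [el, z0]
    · simp [er, z1]
  have hγd : γ * (lam - 2 * α) = (1 - α) ^ 2 := by
    rw [hγ, div_mul_cancel₀ _ hd.ne']
  have hcancel : (lam - 2 * α) * x (Sum.inl 2) * (fs * ft) =
      (lam - 2 * α) * x (Sum.inl 2) * (γ * (fs + ft)) := by
    calc _ = (1 - α) * ((fs * x (Sum.inl 0)) * ft + (ft * x (Sum.inl 1)) * fs) := by
          rw [g2]; ring
      _ = (1 - α) ^ 2 * x (Sum.inl 2) * (fs + ft) := by rw [g0, g1]; ring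
      _ = _ := by rw [← hγd]; ring
  exact mul_left_cancel₀ (mul_ne_zero hd.ne' hc) hcancel

end DoubleBroom
end SimpleGraph

namespace SimpleGraph

/-! ### Graphs with a two-vertex cover -/

section VertexCover

variable {V : Type*} [Fintype V] (G : SimpleGraph V)

/-- The neighbours of `a`, other than `b`, that are not neighbours of `b`. -/
noncomputable def privateNbrs (a b : V) : Finset V :=
  open Classical in Finset.univ.filter fun w => w ≠ b ∧ G.Adj a w ∧ ¬ G.Adj b w

/-- The common neighbours of `a` and `b`. -/
noncomputable def jointNbrs (a b : V) : Finset V :=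
  open Classical in Finset.univ.filter fun w => G.Adj a w ∧ G.Adj b w

variable {G} {a b : V}

theorem mem_privateNbrs {w : V} :
    w ∈ G.privateNbrs a b ↔ w ≠ b ∧ G.Adj a w ∧ ¬ G.Adj b w := by
  simp [privateNbrs]

theorem mem_jointNbrs {w : V} : w ∈ G.jointNbrs a b ↔ G.Adj a w ∧ G.Adj b w := by
  simp [jointNbrs]

/-- A function on the vertices splits along a vertex cover `{a, b}`. -/
theorem sum_eq_of_cover (hab : a ≠ b) (hnb : ∀ w, w ≠ a → w ≠ b → G.Adj a w ∨ G.Adj b w)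
    (f : V → ℝ) :
    ∑ w, f w = f a + f b + (∑ w ∈ G.privateNbrs a b, f w + ∑ w ∈ G.privateNbrs b a, f w +
      ∑ w ∈ G.jointNbrs a b, f w) := by
  classical
  rw [← Finset.add_sum_erase _ _ (Finset.mem_univ a),
    ← Finset.add_sum_erase _ _ (Finset.mem_erase.2 ⟨hab.symm, Finset.mem_univ b⟩), ← add_assoc]
  congr 1
  have hd1 : Disjoint (G.privateNbrs a b) (G.privateNbrs b a) := by
    rw [Finset.disjoint_left]
    intro w h1 h2
    exact (mem_privateNbrs.1 h1).2.2 (mem_privateNbrs.1 h2).2.1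
  have hd2 : Disjoint (G.privateNbrs a b ∪ G.privateNbrs b a) (G.jointNbrs a b) := by
    rw [Finset.disjoint_left]
    intro w h1 h2
    rw [mem_jointNbrs] at h2
    rcases Finset.mem_union.1 h1 with h | h
    · exact (mem_privateNbrs.1 h).2.2 h2.2
    · exact (mem_privateNbrs.1 h).2.2 h2.1
  rw [← Finset.sum_union hd1, ← Finset.sum_union hd2]
  refine Finset.sum_congr ?_ fun _ _ => rfl
  ext w
  simp only [Finset.mem_erase, Finset.mem_univ, and_true, Finset.mem_union, mem_privateNbrs,
    mem_jointNbrs]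
  constructor
  · rintro ⟨h1, h2⟩
    have := hnb w h2 h1
    tauto
  · rintro ((⟨h1, h2, -⟩ | ⟨h1, h2, -⟩) | ⟨h1, h2⟩)
    · exact ⟨h1, h2.ne'⟩
    · exact ⟨h2.ne', h1⟩
    · exact ⟨h2.ne', h1.ne'⟩

theorem card_eq_of_cover (hab : a ≠ b) (hnb : ∀ w, w ≠ a → w ≠ b → G.Adj a w ∨ G.Adj b w) :
    Fintype.card V = 2 + ((G.privateNbrs a b).card + (G.privateNbrs b a).card +
      (G.jointNbrs a b).card) := by
  have := sum_eq_of_cover hab hnb (fun _ => 1)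
  simp only [Finset.sum_const, nsmul_eq_mul, mul_one, Finset.card_univ] at this
  norm_num at this
  exact_mod_cast this

/-- If the index of `G` is at most `lam`, the two-variable form obtained by eliminating the
vertices outside a vertex cover `{a, b}` is nonpositive. -/
theorem form_nonpos_of_alphaIndex_le {α lam β γ : ℝ} {e : ℕ}
    (hab : a ≠ b) (hnb : ∀ w, w ≠ a → w ≠ b → G.Adj a w ∨ G.Adj b w)
    (hcov : ∀ u v, G.Adj u v → u = a ∨ u = b ∨ v = a ∨ v = b)
    (he : (e = 1 ∧ G.Adj a b) ∨ (e = 0 ∧ ¬ G.Adj a b))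
    (hd : 0 < lam - 2 * α) (hd' : 0 < lam - α)
    (hβ : β = α + (1 - α) ^ 2 / (lam - α)) (hγ : γ = (1 - α) ^ 2 / (lam - 2 * α))
    (hle : G.alphaIndex α ≤ lam) (x y : ℝ) :
    (G.privateNbrs a b).card * β * x ^ 2 + (G.privateNbrs b a).card * β * y ^ 2
      + (((G.jointNbrs a b).card + e) * α - lam) * (x ^ 2 + y ^ 2)
      + (G.jointNbrs a b).card * γ * (x + y) ^ 2 + 2 * e * (1 - α) * (x * y) ≤ 0 := by
  classical
  have : Nonempty V := ⟨a⟩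
  obtain ⟨l, hl⟩ : ∃ l, l = (1 - α) * x / (lam - α) := ⟨_, rfl⟩
  obtain ⟨m, hm⟩ : ∃ m, m = (1 - α) * y / (lam - α) := ⟨_, rfl⟩
  obtain ⟨c, hc⟩ : ∃ c, c = (1 - α) * (x + y) / (lam - 2 * α) := ⟨_, rfl⟩
  -- Off the cover, each entry maximizes the form of `A_α - lam` for the given `x`, `y`; its
  -- diagonal coefficient is `α - lam` at a vertex of degree 1 and `2α - lam` at one of degree 2.
  obtain ⟨z, hz⟩ : ∃ z : V → ℝ, z = fun w => if w = a then x else if w = b then y else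
    if G.Adj a w then if G.Adj b w then c else l else m := ⟨_, rfl⟩
  have hza : z a = x := by simp [hz]
  have hzb : z b = y := by simp [hz, hab.symm]
  have hzP : ∀ w ∈ G.privateNbrs a b, z w = l ∧ G.Adj a w ∧ ¬ G.Adj b w := by
    intro w hw
    obtain ⟨h1, h2, h3⟩ := mem_privateNbrs.1 hw
    simp [hz, h1, h2, h3, h2.ne']
  have hzQ : ∀ w ∈ G.privateNbrs b a, z w = m ∧ ¬ G.Adj a w ∧ G.Adj b w := by
    intro w hw
    obtain ⟨h1, h2, h3⟩ := mem_privateNbrs.1 hw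
    simp [hz, h1, h2, h3, h2.ne']
  have hzR : ∀ w ∈ G.jointNbrs a b, z w = c ∧ G.Adj a w ∧ G.Adj b w := by
    intro w hw
    obtain ⟨h2, h3⟩ := mem_jointNbrs.1 hw
    simp [hz, h2, h3, h2.ne', h3.ne']
  have hrow : ∀ w, w ≠ a → w ≠ b → (G.alphaMatrix α).mulVec z w =
      (if G.Adj a w then α * z w + (1 - α) * x else 0) +
        (if G.Adj b w then α * z w + (1 - α) * y else 0) := by
    intro w h1 h2
    rw [alphaMatrix_mulVec, Finset.sum_eq_add a b hab]
    · simp only [hza, hzb, G.adj_comm w]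
    · rintro v - ⟨h3, h4⟩
      rw [if_neg]
      intro h
      rcases hcov _ _ h with h | h | h | h <;> contradiction
    · simp
    · simp
  have hneP : ∀ w ∈ G.privateNbrs a b, w ≠ a ∧ w ≠ b := fun w hw =>
    ⟨(mem_privateNbrs.1 hw).2.1.ne', (mem_privateNbrs.1 hw).1⟩
  have hneQ : ∀ w ∈ G.privateNbrs b a, w ≠ a ∧ w ≠ b := fun w hw =>
    ⟨(mem_privateNbrs.1 hw).1, (mem_privateNbrs.1 hw).2.1.ne'⟩
  have hneR : ∀ w ∈ G.jointNbrs a b, w ≠ a ∧ w ≠ b := fun w hw =>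
    ⟨(mem_jointNbrs.1 hw).1.ne', (mem_jointNbrs.1 hw).2.ne'⟩
  have sumP : ∀ (f : V → ℝ) (k : ℝ), (∀ w ∈ G.privateNbrs a b, f w = k) →
      ∑ w ∈ G.privateNbrs a b, f w = (G.privateNbrs a b).card * k := by
    intro f k h
    rw [Finset.sum_congr rfl h, Finset.sum_const, nsmul_eq_mul]
  have sumQ : ∀ (f : V → ℝ) (k : ℝ), (∀ w ∈ G.privateNbrs b a, f w = k) →
      ∑ w ∈ G.privateNbrs b a, f w = (G.privateNbrs b a).card * k := by
    intro f k h
    rw [Finset.sum_congr rfl h, Finset.sum_const, nsmul_eq_mul]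
  have sumR : ∀ (f : V → ℝ) (k : ℝ), (∀ w ∈ G.jointNbrs a b, f w = k) →
      ∑ w ∈ G.jointNbrs a b, f w = (G.jointNbrs a b).card * k := by
    intro f k h
    rw [Finset.sum_congr rfl h, Finset.sum_const, nsmul_eq_mul]
  have hA : (G.alphaMatrix α).mulVec z a = e * (α * x + (1 - α) * y) +
      ((G.privateNbrs a b).card * (α * x + (1 - α) * l) +
        (G.jointNbrs a b).card * (α * x + (1 - α) * c)) := by
    rw [alphaMatrix_mulVec, sum_eq_of_cover hab hnb, sumP _ (α * x + (1 - α) * l), sumQ _ 0,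
      sumR _ (α * x + (1 - α) * c), hza, hzb]
    · rcases he with ⟨rfl, h⟩ | ⟨rfl, h⟩ <;> simp [h]
    · intro w hw; simp [hzR w hw, hza]
    · intro w hw; simp [hzQ w hw]
    · intro w hw; simp [hzP w hw, hza]
  have hB : (G.alphaMatrix α).mulVec z b = e * (α * y + (1 - α) * x) +
      ((G.privateNbrs b a).card * (α * y + (1 - α) * m) +
        (G.jointNbrs a b).card * (α * y + (1 - α) * c)) := by
    rw [alphaMatrix_mulVec, sum_eq_of_cover hab hnb, sumP _ 0, sumQ _ (α * y + (1 - α) * m),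
      sumR _ (α * y + (1 - α) * c), hza, hzb]
    · rcases he with ⟨rfl, h⟩ | ⟨rfl, h⟩ <;> simp [h, G.adj_comm b a]
    · intro w hw; simp [hzR w hw, hzb]
    · intro w hw; simp [hzQ w hw, hzb]
    · intro w hw; simp [hzP w hw]
  have h := (G.dotProduct_alphaMatrix_mulVec_le α z).trans
    (mul_le_mul_of_nonneg_right hle (Finset.sum_nonneg fun i _ => mul_self_nonneg (z i)))
  rw [dotProduct, dotProduct, sum_eq_of_cover hab hnb, sum_eq_of_cover hab hnb, hA, hB, hza, hzb,
    sumP _ (l * (α * l + (1 - α) * x)), sumQ _ (m * (α * m + (1 - α) * y)),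
    sumR _ (c * (2 * α * c + (1 - α) * (x + y))), sumP _ (l * l), sumQ _ (m * m),
    sumR _ (c * c)] at h
  rotate_left
  · intro w hw; rw [(hzR w hw).1]
  · intro w hw; rw [(hzQ w hw).1]
  · intro w hw; rw [(hzP w hw).1]
  · intro w hw
    rw [hrow w (hneR w hw).1 (hneR w hw).2]
    simp only [hzR w hw, if_true]
    ring
  · intro w hw
    rw [hrow w (hneQ w hw).1 (hneQ w hw).2]
    simp only [hzQ w hw, if_true, if_false, zero_add]
  · intro w hw
    rw [hrow w (hneP w hw).1 (hneP w hw).2]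
    simp only [hzP w hw, if_true, if_false, add_zero]
  have kP := quadratic_at_critical_point hd'.ne' hl
  have kQ := quadratic_at_critical_point hd'.ne' hm
  have kR := quadratic_at_critical_point hd.ne' hc
  have kP' := congrArg (fun u => ((G.privateNbrs a b).card : ℝ) * u) kP
  have kQ' := congrArg (fun u => ((G.privateNbrs b a).card : ℝ) * u) kQ
  have kR' := congrArg (fun u => ((G.jointNbrs a b).card : ℝ) * u) kR
  rw [hβ, hγ]
  linarith

theorem nonempty_iso_doubleBroom {s t : ℕ}
    (hab : a ≠ b) (hnb : ∀ w, w ≠ a → w ≠ b → G.Adj a w ∨ G.Adj b w)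
    (hcov : ∀ u v, G.Adj u v → u = a ∨ u = b ∨ v = a ∨ v = b)
    (hs : (G.privateNbrs a b).card = s) (ht : (G.privateNbrs b a).card = t)
    (hr : (G.jointNbrs a b).card = 1) (he : ¬ G.Adj a b) :
    Nonempty (G ≃g doubleBroom s t) := by
  obtain ⟨c, hc⟩ := Finset.card_eq_one.1 hr
  obtain ⟨hac, hbc⟩ := mem_jointNbrs.1 (hc ▸ Finset.mem_singleton_self c)
  let eP := (Finset.equivFinOfCardEq hs).symm
  let eQ := (Finset.equivFinOfCardEq ht).symm
  let f : Fin 3 ⊕ (Fin s ⊕ Fin t) → V :=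
    Sum.elim ![a, b, c] (Sum.elim (fun i => (eP i : V)) (fun j => (eQ j : V)))
  have hsurj : Function.Surjective f := by
    intro w
    by_cases h1 : w = a
    · exact ⟨Sum.inl 0, h1.symm⟩
    by_cases h2 : w = b
    · exact ⟨Sum.inl 1, h2.symm⟩
    by_cases h3 : G.Adj a w
    · by_cases h4 : G.Adj b w
      · have : w ∈ G.jointNbrs a b := mem_jointNbrs.2 ⟨h3, h4⟩
        rw [hc, Finset.mem_singleton] at this
        exact ⟨Sum.inl 2, this.symm⟩
      · obtain ⟨i, hi⟩ := eP.surjective ⟨w, mem_privateNbrs.2 ⟨h2, h3, h4⟩⟩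
        exact ⟨Sum.inr (Sum.inl i), congrArg Subtype.val hi⟩
    · obtain ⟨j, hj⟩ := eQ.surjective
        ⟨w, mem_privateNbrs.2 ⟨h1, (hnb w h1 h2).resolve_left h3, h3⟩⟩
      exact ⟨Sum.inr (Sum.inr j), congrArg Subtype.val hj⟩
  have hbij : Function.Bijective f := by
    rw [Fintype.bijective_iff_surjective_and_card]
    refine ⟨hsurj, ?_⟩
    rw [card_eq_of_cover hab hnb, hs, ht, hr]
    simp
    omega
  have pP : ∀ i, (eP i : V) ≠ b ∧ G.Adj a (eP i) ∧ ¬ G.Adj b (eP i) := fun i =>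
    mem_privateNbrs.1 (eP i).2
  have pQ : ∀ i, (eQ i : V) ≠ a ∧ G.Adj b (eQ i) ∧ ¬ G.Adj a (eQ i) := fun i =>
    mem_privateNbrs.1 (eQ i).2
  have hind : ∀ u v, u ≠ a → u ≠ b → v ≠ a → v ≠ b → ¬ G.Adj u v := by
    intro u v h1 h2 h3 h4 h
    rcases hcov u v h with h | h | h | h <;> contradiction
  have hPa : ∀ i, (eP i : V) ≠ a := fun i => (pP i).2.1.ne'
  have hQb : ∀ i, (eQ i : V) ≠ b := fun i => (pQ i).2.1.ne'
  have hadj : ∀ u v, G.Adj (f u) (f v) ↔ (doubleBroom s t).Adj u v := by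
    have he' : ¬ G.Adj b a := fun h => he h.symm
    rintro (u | i | j) (v | i' | j')
    · fin_cases u <;> fin_cases v <;>
        simp [f, doubleBroom_adj, doubleBroomEdge_iff, he, he', hac, hac.symm, hbc, hbc.symm]
    · fin_cases u <;>
        simp [f, doubleBroom_adj, doubleBroomEdge_iff, pP, hind, hac.ne', hbc.ne', hPa]
    · fin_cases u <;>
        simp [f, doubleBroom_adj, doubleBroomEdge_iff, pQ, hind, hac.ne', hbc.ne', hQb]
    · fin_cases v <;>
        simp [f, doubleBroom_adj, doubleBroomEdge_iff, pP, hind, hac.ne', hbc.ne', hPa,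
          G.adj_comm (eP i) a, G.adj_comm (eP i) b]
    · simp [f, doubleBroom_adj, doubleBroomEdge_iff, pP, hind, hPa]
    · simp [f, doubleBroom_adj, doubleBroomEdge_iff, pP, pQ, hind, hPa, hQb]
    · fin_cases v <;>
        simp [f, doubleBroom_adj, doubleBroomEdge_iff, pQ, hind, hac.ne', hbc.ne', hQb,
          G.adj_comm (eQ j) a, G.adj_comm (eQ j) b]
    · simp [f, doubleBroom_adj, doubleBroomEdge_iff, pP, pQ, hind, hPa, hQb]
    · simp [f, doubleBroom_adj, doubleBroomEdge_iff, pQ, hind, hQb]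
  exact ⟨(⟨Equiv.ofBijective f hbij, fun {u v} => hadj u v⟩ : doubleBroom s t ≃g G).symm⟩

/-- In a connected graph with vertex cover `{a, b}`, the vertices `a`, `b` are adjacent or have a
common neighbour. -/
theorem Connected.adj_or_jointNbrs_ne_zero (hconn : G.Connected) (hab : a ≠ b)
    (hcov : ∀ u v, G.Adj u v → u = a ∨ u = b ∨ v = a ∨ v = b) :
    (G.jointNbrs a b).card = 0 → G.Adj a b := by
  intro h0
  by_contra hnadj
  -- Without common neighbours, and with `a`, `b` nonadjacent, no walk from `a` leaves its closed
  -- neighbourhood.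
  have hreach : ∀ u, Relation.ReflTransGen G.Adj a u → u = a ∨ G.Adj a u := by
    intro u hu
    induction hu with
    | refl => exact Or.inl rfl
    | @tail v w _ hvw ih =>
      rcases ih with rfl | ih
      · exact Or.inr hvw
      · rcases hcov v w hvw with rfl | rfl | rfl | rfl
        · exact Or.inr hvw
        · contradiction
        · exact Or.inl rfl
        · have : v ∈ G.jointNbrs a w := mem_jointNbrs.2 ⟨ih, hvw.symm⟩
          rw [Finset.card_eq_zero.1 h0] at this
          simp at this
  rcases hreach b ((reachable_iff_reflTransGen _ _).1 (hconn.preconnected a b)) with h | h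
  · exact hab h.symm
  · exact hnadj h

theorem exists_cover_of_indepNum (hconn : G.Connected) (hcard : 2 ≤ Fintype.card V)
    (hindep : G.indepNum = Fintype.card V - 2) :
    ∃ a b : V, a ≠ b ∧ (G.privateNbrs b a).card ≤ (G.privateNbrs a b).card ∧
      (∀ w, w ≠ a → w ≠ b → G.Adj a w ∨ G.Adj b w) ∧
      ∀ u v, G.Adj u v → u = a ∨ u = b ∨ v = a ∨ v = b := by
  classical
  obtain ⟨S, hS⟩ := G.exists_isNIndepSet_indepNum
  have hc : Sᶜ.card = 2 := by
    rw [Finset.card_compl, hS.card_eq, hindep]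
    omega
  obtain ⟨a, b, hab, hSab⟩ := Finset.card_eq_two.1 hc
  have hmem : ∀ w, w ≠ a → w ≠ b → w ∈ S := by
    intro w h1 h2
    by_contra h
    have : w ∈ Sᶜ := Finset.mem_compl.2 h
    rw [hSab] at this
    simp [h1, h2] at this
  have hcov : ∀ u v, G.Adj u v → u = a ∨ u = b ∨ v = a ∨ v = b := by
    intro u v h
    by_contra! hcon
    exact hS.isIndepSet (hmem u hcon.1 hcon.2.1) (hmem v hcon.2.2.1 hcon.2.2.2) h.ne h
  have hnb : ∀ w, w ≠ a → w ≠ b → G.Adj a w ∨ G.Adj b w := by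
    intro w h1 h2
    have : Nontrivial V := ⟨a, b, hab⟩
    obtain ⟨v, hv⟩ := hconn.preconnected.exists_adj_of_nontrivial w
    rcases hcov w v hv with rfl | rfl | rfl | rfl
    · contradiction
    · contradiction
    · exact Or.inl hv.symm
    · exact Or.inr hv.symm
  -- The two cover vertices are named so that `a` has at least as many private neighbours, matching
  -- `t ≤ s`.
  rcases le_total (G.privateNbrs b a).card (G.privateNbrs a b).card with h | h
  · exact ⟨a, b, hab, h, hnb, hcov⟩
  · exact ⟨b, a, hab.symm, h, fun w h1 h2 => (hnb w h2 h1).symm, fun u v huv => by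
      have := hcov u v huv
      tauto⟩

/-- A connected graph with independence number two less than its order whose index is at most
that of the balanced double broom of the same order is that double broom. -/
theorem nonempty_iso_doubleBroom_of_alphaIndex_le {s t : ℕ} {α : ℝ} (hα₀ : 0 ≤ α) (hα₁ : α < 1)
    (ht : 1 ≤ t) (hst : s = t ∨ s = t + 1) (hcard : Fintype.card V = s + t + 3)
    (hconn : G.Connected) (hindep : G.indepNum = Fintype.card V - 2)
    (hle : G.alphaIndex α ≤ (doubleBroom s t).alphaIndex α) :
    Nonempty (G ≃g doubleBroom s t) := by
  classical
  obtain ⟨a, b, hab, hpq, hnb, hcov⟩ := exists_cover_of_indepNum hconn (by omega) hindep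
  have hd := doubleBroom_alphaIndex_gt s t α (by omega) hα₀ hα₁
  obtain ⟨lam, hlam⟩ : ∃ lam, lam = (doubleBroom s t).alphaIndex α := ⟨_, rfl⟩
  rw [← hlam] at hle hd
  obtain ⟨hfs, hsec⟩ := doubleBroom_secular s t α (by omega) hα₀ hα₁ hlam rfl rfl rfl rfl
  obtain ⟨e, he⟩ : ∃ e : ℕ, (e = 1 ∧ G.Adj a b) ∨ (e = 0 ∧ ¬ G.Adj a b) := by
    by_cases h : G.Adj a b
    · exact ⟨1, Or.inl ⟨rfl, h⟩⟩
    · exact ⟨0, Or.inr ⟨rfl, h⟩⟩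
  have hsum := card_eq_of_cover hab hnb
  obtain ⟨h1, h2, h3, h4⟩ := params_eq_of_form_nonpos hα₀ (sub_pos.2 hα₁) (by linarith) rfl rfl
    ht hst rfl rfl hfs hsec hpq (by omega) (by omega) (fun h0 => by
      have := hconn.adj_or_jointNbrs_ne_zero hab hcov h0
      tauto)
    (form_nonpos_of_alphaIndex_le hab hnb hcov he (by linarith) (by linarith) rfl rfl hle)
  refine nonempty_iso_doubleBroom hab hnb hcov h1 h2 h3 ?_
  rcases he with ⟨h, -⟩ | ⟨-, h⟩
  · omega
  · exact h

end VertexCover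
end SimpleGraph

/-! ### Rounding and the main theorem -/

theorem ceil_floor_half_sub_three (n : ℕ) (hn : 5 ≤ n) :
    ∃ s t : ℕ, ⌈((n : ℚ) - 3) / 2⌉₊ = s ∧ ⌊((n : ℚ) - 3) / 2⌋₊ = t ∧ 1 ≤ t ∧
      (s = t ∨ s = t + 1) ∧ n = s + t + 3 := by
  obtain ⟨k, hk | hk⟩ : ∃ k : ℕ, n = 2 * k + 3 ∨ n = 2 * k + 4 := ⟨(n - 3) / 2, by omega⟩
  · refine ⟨k, k, ?_, ?_, by omega, Or.inl rfl, by omega⟩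
    · rw [hk, show (((2 * k + 3 : ℕ) : ℚ) - 3) / 2 = k by push_cast; ring, Nat.ceil_natCast]
    · rw [hk, show (((2 * k + 3 : ℕ) : ℚ) - 3) / 2 = k by push_cast; ring, Nat.floor_natCast]
  · have h : (((2 * k + 4 : ℕ) : ℚ) - 3) / 2 = k + 1 / 2 := by
      push_cast
      ring
    refine ⟨k + 1, k, ?_, ?_, by omega, Or.inr rfl, by omega⟩
    · rw [hk, h, Nat.ceil_eq_iff (by omega)]
      constructor
      · simp
      · push_cast
        linarith
    · rw [hk, h, Nat.floor_eq_iff (by positivity)]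
      constructor <;> linarith

theorem theorem1p2 (n : ℕ) (hn : 5 ≤ n) (α : ℝ) (hα₀ : 0 ≤ α) (hα₁ : α < 1)
    {V : Type*} [Fintype V] (hV : Fintype.card V = n)
    (G : SimpleGraph V) (hconn : G.Connected) (hindep : G.indepNum = n - 2) :
    (SimpleGraph.doubleBroom ⌈((n : ℚ) - 3) / 2⌉₊ ⌊((n : ℚ) - 3) / 2⌋₊).alphaIndex α
        ≤ G.alphaIndex α ∧
      (G.alphaIndex α =
          (SimpleGraph.doubleBroom ⌈((n : ℚ) - 3) / 2⌉₊ ⌊((n : ℚ) - 3) / 2⌋₊).alphaIndex α ↔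
        Nonempty
          (G ≃g SimpleGraph.doubleBroom ⌈((n : ℚ) - 3) / 2⌉₊ ⌊((n : ℚ) - 3) / 2⌋₊)) := by
  obtain ⟨s, t, hs, ht, ht1, hst, hn'⟩ := ceil_floor_half_sub_three n hn
  rw [hs, ht]
  have key := SimpleGraph.nonempty_iso_doubleBroom_of_alphaIndex_le hα₀ hα₁ ht1 hst
    (hV.trans hn') hconn (hV.symm ▸ hindep)
  refine ⟨?_, fun h => key h.le, fun ⟨f⟩ => SimpleGraph.alphaIndex_eq_of_iso f α⟩
  -- A strictly smaller index would also force an isomorphism, hence equal indices.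
  by_contra! h
  obtain ⟨f⟩ := key h.le
  exact h.ne (SimpleGraph.alphaIndex_eq_of_iso f α)
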